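/- Notation. $f\le^* g$ means $f(n)\le g(n)$ for all but finitely many $n$. $\mathfrak b$ (resp. $\mathfrak d$) is the least cardinality of a subset of $\mathbb N^{\mathbb N}$ that is unbounded (resp. dominating) with respect to $\le^*$. A $\mathfrak b$-scale is a $\le^*$-unbounded set $\{g_\alpha:\alpha<\mathfrak b\}$ of strictly increasing functions in $\mathbb N^{\mathbb N}$ with $g_\alpha\le^* g_\beta$ for all $\alpha<\beta<\mathfrak b$. For a topological space $X$, $\mathcal O$ is the collection of countable open covers of $X$ that do not have $X$ itself as a member, and $\Gamma\subseteq\mathcal O$ is the collection of those $\mathcal U\in\mathcal O$ that are infinite and such that each point of $X$ belongs to all but finitely many members of $\mathcal U$. $X$ satisfies $S_1(\mathcal A,\mathcal B)$ if for each sequence $(\mathcal U_n)_{n\in\mathbb N}$ of members of $\mathcal A$ there are $U_n\in\mathcal U_n$ with $\{U_n:n\in\mathbb N\}\in\mathcal B$. $X$ satisfies $U_{fin}(\mathcal A,\mathcal B)$ if for each sequence $(\mathcal U_n)_{n\in\mathbb N}$ of members of $\mathcal A$, none of which contains a finite subcover, there are finite (possibly empty) $\mathcal F_n\subseteq\mathcal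 U_n$ with $\{\bigcup\mathcal F_n:n\in\mathbb N\}\in\mathcal B$. Let $\mathrm{Inc}\subseteq(\mathbb N\cup\{\infty\})^{\mathbb N}$ be the space of all nondecreasing $x$ such that $x(n)<x(n+1)$ whenever $x(n)<\infty$, where $\mathbb N\cup\{\infty\}$ is the one-point compactification of the discrete space $\mathbb N$ and the power has the product topology. Let $Q\subseteq \mathrm{Inc}$ be the countable set of all $q_s$, where $s$ is a finite strictly increasing sequence of natural numbers, $q_s(k)=s(k)$ for $k<|s|$ and $q_s(k)=\infty$ for $k\ge|s|$. Theorem. The space $\mathrm{Inc}$ is homeomorphic to the Cantor space $\{0,1\}^{\mathbb N}$, and (in ZFC) there are a $\mathfrak b$-scale $B$ and a set $H\subseteq\mathrm{Inc}$, namely $H=B\cup Q$, such that $H$ is not $\sigma$-compact and: 1. $|H|=\mathfrak b$; 2. $H$ satisfies $S_1(\Gamma,\mathcal O)$, and all finite powers $H^k$ of $H$ satisfy $U_{fin}(\Gamma,\Gamma)$ (in particular $H$ itself does), but $H\setminus Q$ does not satisfy $U_{fin}(\Gamma,\Gamma)$; 3. if $\mathfrak b=\mathfrak d$, then $H\setminus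 Q$ does not satisfy $U_{fin}(\Gamma,\mathcal O)$. In particular, $H$ is a counterexample to the Hurewicz conjecture that $U_{fin}(\Gamma,\Gamma)$ implies $\sigma$-compactness, and it shows that $U_{fin}(\Gamma,\Gamma)$ is not hereditary. -/

import Mathlib

open Filter Set
open scoped Cardinal

namespace SelectionPrinciples

/-! ### Covers and selection principles -/

section Covers

variable {X : Type*} [TopologicalSpace X]

/-- The collection `𝒪` of countable open covers of `X`; as usual in this area, the whole space
is not allowed as a member of a cover. -/
def openCovers (X : Type*) [TopologicalSpace X] : Set (Set (Set X)) :=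
  {U | U.Countable ∧ (∀ V ∈ U, IsOpen V) ∧ ⋃₀ U = univ ∧ univ ∉ U}

/-- The collection `Γ` of countable open `γ`-covers of `X`: countable open covers that are
infinite and such that each point belongs to all but finitely many members. -/
def gammaCovers (X : Type*) [TopologicalSpace X] : Set (Set (Set X)) :=
  {U | U ∈ openCovers X ∧ U.Infinite ∧ ∀ x : X, {V ∈ U | x ∉ V}.Finite}

/-- `S₁(𝒜, ℬ)`: from each sequence of members of `𝒜` one can choose one element of each term
so that the family of chosen elements is in `ℬ`. -/
def SOne {X : Type*} (A B : Set (Set (Set X))) : Prop :=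
  ∀ U : ℕ → Set (Set X), (∀ n, U n ∈ A) →
    ∃ V : ℕ → Set X, (∀ n, V n ∈ U n) ∧ range V ∈ B

/-- `U` contains a finite subcover of `X`. -/
def HasFiniteSubcover {X : Type*} (U : Set (Set X)) : Prop :=
  ∃ F ⊆ U, F.Finite ∧ ⋃₀ F = univ

/-- `U_fin(𝒜, ℬ)`: for each sequence of members of `𝒜` which do not contain a finite subcover,
there are finite (possibly empty) subsets `F n ⊆ U n` such that the family
`{⋃ F n : n ∈ ℕ}` is in `ℬ`. -/
def UFin {X : Type*} (A B : Set (Set (Set X))) : Prop :=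
  ∀ U : ℕ → Set (Set X), (∀ n, U n ∈ A) → (∀ n, ¬ HasFiniteSubcover (U n)) →
    ∃ F : ℕ → Set (Set X), (∀ n, F n ⊆ U n ∧ (F n).Finite) ∧
      range (fun n => ⋃₀ F n) ∈ B

end Covers

/-! ### Eventual domination, the cardinals `𝔟` and `𝔡`, and `𝔟`-scales -/

/-- `f ≤* g`: `f n ≤ g n` for all but finitely many `n`. -/
def LEStar (f g : ℕ → ℕ) : Prop := ∀ᶠ n in atTop, f n ≤ g n

/-- A set of functions is bounded if a single function `≤*`-bounds all its members. -/
def IsBoundedStar (Y : Set (ℕ → ℕ)) : Prop := ∃ g, ∀ f ∈ Y, LEStar f g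

/-- A set of functions is dominating if each function is `≤*`-below some member. -/
def IsDominating (Y : Set (ℕ → ℕ)) : Prop := ∀ g, ∃ f ∈ Y, LEStar g f

/-- The bounding number `𝔟`: the least cardinality of an unbounded subset of `ℕ^ℕ`. -/
noncomputable def boundingNumber : Cardinal.{0} :=
  sInf {κ | ∃ Y : Set (ℕ → ℕ), ¬ IsBoundedStar Y ∧ #Y = κ}

/-- The dominating number `𝔡`: the least cardinality of a dominating subset of `ℕ^ℕ`. -/
noncomputable def dominatingNumber : Cardinal.{0} :=
  sInf {κ | ∃ Y : Set (ℕ → ℕ), IsDominating Y ∧ #Y = κ}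

/-- A `𝔟`-scale: an unbounded set `{g α : α < 𝔟}` of (strictly) increasing functions such that
`g α ≤* g β` whenever `α < β < 𝔟`. -/
def IsBScale (B : Set (ℕ → ℕ)) : Prop :=
  ¬ IsBoundedStar B ∧ (∀ f ∈ B, StrictMono f) ∧
    ∃ g : Ordinal.{0} → ℕ → ℕ, B = g '' Iio boundingNumber.ord ∧
      ∀ α β, α < β → β < boundingNumber.ord → LEStar (g α) (g β)

/-! ### The space `Inc` and its countable subset `Q`

The order topology of `ℕ∞` is that of the one-point compactification of the discrete space `ℕ`,
and `ℕ → ℕ∞` carries the product topology. -/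

/-- The nondecreasing `x : ℕ → ℕ ∪ {∞}` with `x n < x (n + 1)` whenever `x n < ∞`. -/
def Inc : Set (ℕ → ℕ∞) :=
  {x | Monotone x ∧ ∀ n, x n < ⊤ → x n < x (n + 1)}

/-- The function `q_s`: it is `s k` for `k < |s|`, and `∞` otherwise. -/
def qSeq (s : List ℕ) : ℕ → ℕ∞ :=
  fun k => if h : k < s.length then (s[k] : ℕ∞) else ⊤

/-- The set of all `q_s`, for `s` an increasing finite sequence of natural numbers. -/
def Q : Set (ℕ → ℕ∞) :=
  {x | ∃ s : List ℕ, s.Pairwise (· < ·) ∧ x = qSeq s}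

/-- The inclusion of `ℕ^ℕ` into `(ℕ ∪ {∞})^ℕ`. -/
def toENatSeq (f : ℕ → ℕ) : ℕ → ℕ∞ := fun n => (f n : ℕ∞)

end SelectionPrinciples

open SelectionPrinciples

namespace SelectionPrinciples

/-! Recording the set of finite values of a sequence identifies `Inc` with the Cantor space. The
scale B comes from a recursion of length 𝔟 along an unbounded family of size 𝔟, which is taken
dominating if 𝔟 = 𝔡.

The positive properties hold because B concentrates on Q. A point of `Inc` with an infinite
coordinate lies in Q, so by compactness an open set containing Q^k contains, for each n, all points
of Inc^k whose entries are at least some g(n) at n (`exists_forall_le_imp_mem`). All but fewer than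
𝔟 members of B exceed g almost everywhere on one infinite set (`IsBScale.exists_infinite_le`), and
the fewer than 𝔟 exceptions are controlled by a single bound. In powers the exceptions fill fewer
than 𝔟 slices, which are treated by induction (`IsBScale.isHurewicz_pow`). For S₁(Γ, 𝒪), half of the
covers serve Q and half the exceptions.

If H were σ-compact, then, being uncountable, it would contain a Cantor set, which
`not_sOne_of_cantor` forbids. Once Q is removed, the covers {x | x n < m} turn a selection into a
bound that contradicts unboundedness or domination. -/

/-! ### The space `Inc` and its homeomorphism with the Cantor space -/

theorem mem_Inc_iff {x : ℕ → ℕ∞} : x ∈ Inc ↔ ∀ n, x n + 1 ≤ x (n + 1) := by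
  constructor
  · rintro ⟨h1, h2⟩ n
    rcases eq_or_ne (x n) ⊤ with h | h
    · have := h1 (Nat.le_succ n)
      rw [h] at this ⊢
      simpa using this
    · exact Order.add_one_le_of_lt (h2 n (lt_top_iff_ne_top.2 h))
  · intro h
    refine ⟨monotone_nat_of_le_succ fun n => le_self_add.trans (h n), fun n hn => ?_⟩
    exact (ENat.add_one_le_iff hn.ne).1 (h n)

theorem isClosed_Inc : IsClosed Inc := by
  have : Inc = ⋂ n, {x : ℕ → ℕ∞ | x n + 1 ≤ x (n + 1)} := by
    ext x; simp [mem_Inc_iff]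
  rw [this]
  exact isClosed_iInter fun n => isClosed_le (by fun_prop) (by fun_prop)

theorem isCompact_Inc : IsCompact Inc := isClosed_Inc.isCompact

theorem le_apply_of_mem_Inc {x : ℕ → ℕ∞} (hx : x ∈ Inc) (n : ℕ) : (n : ℕ∞) ≤ x n := by
  induction n with
  | zero => simp
  | succ n ih =>
    push_cast
    exact (add_le_add_left ih 1).trans (mem_Inc_iff.1 hx n)

theorem lt_of_mem_Inc {x : ℕ → ℕ∞} (hx : x ∈ Inc) {m n : ℕ} (h : m < n) (hm : x m ≠ ⊤) :
    x m < x n :=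
  (hx.2 m (lt_top_iff_ne_top.2 hm)).trans_le (hx.1 h)

theorem qSeq_mem_Inc {s : List ℕ} (hs : s.Pairwise (· < ·)) : qSeq s ∈ Inc := by
  rw [mem_Inc_iff]
  intro n
  unfold qSeq
  by_cases h : n + 1 < s.length
  · have h' : n < s.length := by omega
    simp only [h, h', dif_pos]
    have := List.pairwise_iff_getElem.1 hs n (n + 1) h' h (by omega)
    exact_mod_cast this
  · simp [h]

theorem Q_subset_Inc : Q ⊆ Inc := by
  rintro x ⟨s, hs, rfl⟩
  exact qSeq_mem_Inc hs

theorem countable_Q : Q.Countable :=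
  (countable_range qSeq).mono (by rintro _ ⟨s, _, rfl⟩; exact ⟨s, rfl⟩)

theorem exists_eq_top_of_mem_Q {x : ℕ → ℕ∞} (hx : x ∈ Q) : ∃ n, x n = ⊤ := by
  obtain ⟨s, _, rfl⟩ := hx
  exact ⟨s.length, by simp [qSeq]⟩

theorem mem_Q_of_mem_Inc {x : ℕ → ℕ∞} (hx : x ∈ Inc) {n : ℕ} (h : x n = ⊤) : x ∈ Q := by
  classical
  have hex : ∃ n, x n = ⊤ := ⟨n, h⟩
  have hlt : ∀ k < Nat.find hex, x k ≠ ⊤ := fun k hk => Nat.find_min hex hk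
  refine ⟨(List.range (Nat.find hex)).map fun k => (x k).toNat, ?_, ?_⟩
  · rw [List.pairwise_iff_getElem]
    intro i j hi hj hij
    simp only [List.length_map, List.length_range] at hi hj
    have := lt_of_mem_Inc hx hij (hlt i hi)
    rw [← ENat.natCast_toNat (hlt i hi), ← ENat.natCast_toNat (hlt j hj)] at this
    simpa using this
  · funext k
    unfold qSeq
    by_cases hk : k < Nat.find hex
    · simp [hk, ENat.natCast_toNat (hlt k hk)]
    · have := hx.1 (not_lt.1 hk)
      rw [Nat.find_spec hex] at this
      simpa [hk] using this

theorem toENatSeq_injective : Function.Injective toENatSeq := fun f g h => by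
  funext n
  have := congrFun h n
  simpa [toENatSeq] using this

theorem toENatSeq_mem_Inc {f : ℕ → ℕ} (hf : StrictMono f) : toENatSeq f ∈ Inc := by
  rw [mem_Inc_iff]
  intro n
  have : f n + 1 ≤ f (n + 1) := hf (Nat.lt_succ_self n)
  simp only [toENatSeq]
  exact_mod_cast this

theorem toENatSeq_notMem_Q (f : ℕ → ℕ) : toENatSeq f ∉ Q := fun h => by
  obtain ⟨n, hn⟩ := exists_eq_top_of_mem_Q h
  simp [toENatSeq] at hn

/-- The characteristic function of the set of finite values of a sequence. -/
noncomputable def valueIndicator (x : Inc) : ℕ → Bool :=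
  open Classical in fun n => decide (∃ k ≤ n, x.1 k = n)

theorem valueIndicator_eq_true {x : Inc} {n : ℕ} :
    valueIndicator x n = true ↔ ∃ k, x.1 k = n := by
  simp only [valueIndicator, decide_eq_true_eq]
  refine ⟨fun ⟨k, _, h⟩ => ⟨k, h⟩, fun ⟨k, h⟩ => ⟨k, ?_, h⟩⟩
  have := le_apply_of_mem_Inc x.2 k
  rw [h] at this
  exact_mod_cast this

theorem isClopen_singleton_natCast (n : ℕ) : IsClopen ({(n : ℕ∞)} : Set ℕ∞) :=
  ⟨isClosed_singleton, ENat.isOpen_singleton (ENat.natCast_ne_top n)⟩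

theorem continuous_valueIndicator : Continuous valueIndicator := by
  refine continuous_pi fun n => ?_
  refine (IsLocallyConstant.iff_exists_open _).2 ?_ |>.continuous
  -- The restriction k ≤ n makes this a finite union of clopen sets; it loses nothing because k ≤ x
  -- k on `Inc`.
  have hclopen : IsClopen {x : Inc | ∃ k ≤ n, x.1 k = n} := by
    have : {x : Inc | ∃ k ≤ n, x.1 k = n} =
        ⋃ k ∈ Set.Iic n, (fun x : Inc => x.1 k) ⁻¹' {(n : ℕ∞)} := by
      ext x; simp
    rw [this]
    exact (Set.finite_Iic n).isClopen_biUnion fun k _ =>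
      (isClopen_singleton_natCast n).preimage ((continuous_apply k).comp continuous_subtype_val)
  intro x
  by_cases hx : ∃ k ≤ n, x.1 k = n
  · refine ⟨_, hclopen.2, hx, fun y (hy : ∃ k ≤ n, y.1 k = n) => ?_⟩
    simp only [valueIndicator, hx, hy]
  · refine ⟨_, hclopen.1.isOpen_compl, hx, fun y (hy : ¬ ∃ k ≤ n, y.1 k = n) => ?_⟩
    simp only [valueIndicator, hx, hy]

/-- If x k < y k, then y takes the value x k before k, where it agrees with x; so x takes a finite
value twice. -/
theorem not_lt_of_values_subset {x y : ℕ → ℕ∞} (hx : x ∈ Inc) (hy : y ∈ Inc)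
    (h : ∀ n : ℕ, (∃ k, x k = n) → ∃ k, y k = n) {k : ℕ} (ih : ∀ j < k, x j = y j) :
    ¬ x k < y k := by
  intro hlt
  have hxk : x k ≠ ⊤ := hlt.ne_top
  obtain ⟨j, hj⟩ := h (x k).toNat ⟨k, (ENat.natCast_toNat hxk).symm⟩
  rw [ENat.natCast_toNat hxk] at hj
  have hjk : j < k := by
    by_contra hc
    exact absurd (hy.1 (not_lt.1 hc)) (by rw [hj]; exact not_le.2 hlt)
  rw [← ih j hjk] at hj
  exact (lt_of_mem_Inc hx hjk (hj ▸ hxk)).ne hj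

theorem valueIndicator_injective : Function.Injective valueIndicator := by
  intro x y h
  have hxy : ∀ n : ℕ, (∃ k, x.1 k = n) ↔ ∃ k, y.1 k = n := fun n => by
    rw [← valueIndicator_eq_true, ← valueIndicator_eq_true, h]
  refine Subtype.ext (funext fun k => ?_)
  induction k using Nat.strong_induction_on with
  | _ k ih =>
    exact le_antisymm
      (not_lt.1 (not_lt_of_values_subset y.2 x.2 (fun n => (hxy n).2) fun j hj => (ih j hj).symm))
      (not_lt.1 (not_lt_of_values_subset x.2 y.2 (fun n => (hxy n).1) ih))

theorem valueIndicator_surjective : Function.Surjective valueIndicator := by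
  classical
  intro a
  let p : ℕ → Prop := fun n => a n = true
  -- `c k` says that the set has more than k elements, vacuously if it is infinite; `x` enumerates
  -- it and continues with ∞.
  let c : ℕ → Prop := fun k => ∀ hf : (Set.ofPred p).Finite, k < hf.toFinset.card
  let x : ℕ → ℕ∞ := fun k => if c k then (Nat.nth p k : ℕ∞) else ⊤
  have hx : x ∈ Inc := by
    rw [mem_Inc_iff]
    intro n
    by_cases h : c (n + 1)
    · have h' : c n := fun hf => (Nat.lt_succ_self n).trans (h hf)
      simp only [x, h, h', if_true]
      exact_mod_cast Nat.nth_lt_nth' (Nat.lt_succ_self n) h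
    · simp [x, h]
  refine ⟨⟨x, hx⟩, funext fun n => ?_⟩
  rw [Bool.eq_iff_iff, valueIndicator_eq_true]
  constructor
  · rintro ⟨k, hk⟩
    by_cases h : c k
    · have hk' : Nat.nth p k = n := by simpa [x, h] using hk
      exact hk' ▸ Nat.nth_mem k h
    · simp [x, h] at hk
  · intro hn
    obtain ⟨k, hk, hkn⟩ := Nat.exists_lt_card_nth_eq (p := p) hn
    have : c k := hk
    exact ⟨k, by simp [x, this, hkn]⟩

theorem nonempty_homeomorph_Inc : Nonempty (Inc ≃ₜ (ℕ → Bool)) := by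
  have : CompactSpace Inc := isCompact_iff_compactSpace.1 isCompact_Inc
  exact ⟨Continuous.homeoOfEquivCompactToT2
    (f := Equiv.ofBijective _ ⟨valueIndicator_injective, valueIndicator_surjective⟩)
    continuous_valueIndicator⟩

theorem polishSpace_Inc : PolishSpace Inc :=
  have : PolishSpace (ℕ → Bool) := {}
  nonempty_homeomorph_Inc.some.isClosedEmbedding.polishSpace

/-! ### Independent closed sets in the Cantor space -/

/-- Disjoint sets in the Cantor space, for fixed `n`, which are independent for different `n`. -/
def codeSet (n m : ℕ) : Set (ℕ → Bool) :=
  {a | a (Nat.pair n m) = true ∧ ∀ j < m, a (Nat.pair n j) = false}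

theorem isClosed_codeSet (n m : ℕ) : IsClosed (codeSet n m) := by
  have : codeSet n m = {a | a (Nat.pair n m) = true} ∩
      ⋂ j, ⋂ (_ : j < m), {a | a (Nat.pair n j) = false} := by
    ext a; simp [codeSet]
  rw [this]
  refine (isClosed_eq (by fun_prop) (by fun_prop)).inter ?_
  exact isClosed_iInter fun j => isClosed_iInter fun _ => isClosed_eq (by fun_prop) (by fun_prop)

theorem eq_of_mem_codeSet {n m m' : ℕ} {a : ℕ → Bool} (h : a ∈ codeSet n m)
    (h' : a ∈ codeSet n m') : m = m' := by
  by_contra hne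
  rcases lt_or_gt_of_ne hne with hlt | hlt
  · simpa [h.1] using h'.2 m hlt
  · simpa [h'.1] using h.2 m' hlt

theorem exists_mem_codeSet (m : ℕ → ℕ) : ∃ a, ∀ n, a ∈ codeSet n (m n) := by
  refine ⟨fun k => decide (k.unpair.2 = m k.unpair.1), fun n => ⟨by simp, fun j hj => ?_⟩⟩
  simpa using hj.ne

/-! ### The cardinals 𝔟 and 𝔡, and existence of 𝔟-scales -/

theorem LEStar.trans {f g h : ℕ → ℕ} (h1 : LEStar f g) (h2 : LEStar g h) : LEStar f h := by
  filter_upwards [h1, h2] with n hn1 hn2 using hn1.trans hn2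

theorem not_isBoundedStar_univ : ¬ IsBoundedStar univ := by
  rintro ⟨g, hg⟩
  obtain ⟨n, hn⟩ := (hg (fun n => g n + 1) (mem_univ _)).exists
  exact absurd hn (Nat.not_succ_le_self _)

theorem exists_unbounded_card_eq :
    ∃ Y : Set (ℕ → ℕ), ¬ IsBoundedStar Y ∧ #Y = boundingNumber :=
  csInf_mem (s := {κ | ∃ Y : Set (ℕ → ℕ), ¬ IsBoundedStar Y ∧ #Y = κ})
    ⟨_, univ, not_isBoundedStar_univ, rfl⟩

theorem exists_dominating_card_eq :
    ∃ Y : Set (ℕ → ℕ), IsDominating Y ∧ #Y = dominatingNumber :=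
  csInf_mem (s := {κ | ∃ Y : Set (ℕ → ℕ), IsDominating Y ∧ #Y = κ})
    ⟨_, univ, fun g => ⟨g, mem_univ _, Eventually.of_forall fun _ => le_rfl⟩, rfl⟩

theorem boundingNumber_le {Y : Set (ℕ → ℕ)} (hY : ¬ IsBoundedStar Y) : boundingNumber ≤ #Y :=
  csInf_le' ⟨Y, hY, rfl⟩

theorem isBoundedStar_of_card_lt {Y : Set (ℕ → ℕ)} (hY : #Y < boundingNumber) :
    IsBoundedStar Y := by
  by_contra h
  exact (boundingNumber_le h).not_gt hY

theorem exists_bound_of_card_lt {ι : Type} (hι : #ι < boundingNumber) (f : ι → ℕ → ℕ) :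
    ∃ g : ℕ → ℕ, ∀ i, LEStar (f i) g := by
  obtain ⟨g, hg⟩ := isBoundedStar_of_card_lt (Cardinal.mk_range_le.trans_lt hι : #(range f) < _)
  exact ⟨g, fun i => hg _ (mem_range_self i)⟩

theorem IsDominating.not_isBoundedStar {Y : Set (ℕ → ℕ)} (hY : IsDominating Y) :
    ¬ IsBoundedStar Y := by
  rintro ⟨g, hg⟩
  obtain ⟨f, hf, hgf⟩ := hY fun n => g n + 1
  obtain ⟨n, h1, h2⟩ := ((hg f hf).and hgf).exists
  exact absurd (h2.trans h1) (Nat.not_succ_le_self _)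

theorem isBoundedStar_of_countable {Y : Set (ℕ → ℕ)} (hY : Y.Countable) : IsBoundedStar Y := by
  rcases Y.eq_empty_or_nonempty with rfl | hne
  · exact ⟨0, by simp⟩
  obtain ⟨e, rfl⟩ := hY.exists_eq_range hne
  refine ⟨fun n => ∑ i ∈ Finset.range (n + 1), e i n, ?_⟩
  rintro _ ⟨i, rfl⟩
  filter_upwards [eventually_ge_atTop i] with n hn
  exact Finset.single_le_sum (f := fun i => e i n) (fun _ _ => Nat.zero_le _)
    (Finset.mem_range.2 (by omega))

theorem aleph0_lt_boundingNumber : ℵ₀ < boundingNumber := by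
  obtain ⟨Y, hY, hcard⟩ := exists_unbounded_card_eq
  by_contra h
  exact hY (isBoundedStar_of_countable (Cardinal.le_aleph0_iff_set_countable.1
    (hcard ▸ not_lt.1 h)))

/-- An increasing function above two given functions. -/
def increasingMajorant (f y : ℕ → ℕ) (n : ℕ) : ℕ := ∑ i ∈ Finset.range (n + 1), (f i + y i + 1)

theorem strictMono_increasingMajorant (f y : ℕ → ℕ) : StrictMono (increasingMajorant f y) :=
  strictMono_nat_of_lt_succ fun n => by
    simp only [increasingMajorant, Finset.sum_range_succ _ (n + 1)]
    omega

theorem le_increasingMajorant (f y : ℕ → ℕ) (n : ℕ) : f n + y n ≤ increasingMajorant f y n := by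
  simp only [increasingMajorant, Finset.sum_range_succ _ n]
  omega

theorem mk_image_Iio_le (g : Ordinal.{0} → ℕ → ℕ) (α : Ordinal.{0}) : #(g '' Iio α) ≤ α.card := by
  have h := Cardinal.mk_image_le_lift (f := g) (s := Iio α)
  rw [Cardinal.mk_Iio_ordinal, Cardinal.lift_lift] at h
  exact Cardinal.lift_le.1 h

/-- The transfinite construction of a scale above a given enumeration. -/
noncomputable def scaleFrom (y : Ordinal.{0} → ℕ → ℕ) (α : Ordinal.{0}) : ℕ → ℕ :=
  increasingMajorant
    (open Classical in
      if h : ∃ f, ∀ β : Iio α, LEStar (scaleFrom y β) f then h.choose else 0) (y α)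
termination_by α
decreasing_by exact β.2

/-- Fewer than 𝔟 predecessors have a common bound, so the default value 0 in the recursion is never
used below 𝔟. -/
theorem scaleFrom_eq (y : Ordinal.{0} → ℕ → ℕ) {α : Ordinal.{0}}
    (hα : α < boundingNumber.ord) :
    ∃ f, (∀ β < α, LEStar (scaleFrom y β) f) ∧ scaleFrom y α = increasingMajorant f (y α) := by
  have h : ∃ f, ∀ β : Iio α, LEStar (scaleFrom y β) f := by
    obtain ⟨f, hf⟩ := isBoundedStar_of_card_lt
      ((mk_image_Iio_le (scaleFrom y) α).trans_lt (Cardinal.lt_ord.1 hα))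
    exact ⟨f, fun β => hf _ (mem_image_of_mem _ β.2)⟩
  refine ⟨h.choose, fun β hβ => h.choose_spec ⟨β, hβ⟩, ?_⟩
  rw [scaleFrom, dif_pos h]

theorem exists_isBScale :
    ∃ B, IsBScale B ∧ (boundingNumber = dominatingNumber → IsDominating B) := by
  obtain ⟨Y, hY, hcard, hdom⟩ : ∃ Y : Set (ℕ → ℕ), ¬ IsBoundedStar Y ∧ #Y = boundingNumber ∧
      (boundingNumber = dominatingNumber → IsDominating Y) := by
    by_cases h : boundingNumber = dominatingNumber
    · obtain ⟨Y, hY, hc⟩ := exists_dominating_card_eq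
      exact ⟨Y, hY.not_isBoundedStar, hc.trans h.symm, fun _ => hY⟩
    · obtain ⟨Y, hY, hc⟩ := exists_unbounded_card_eq
      exact ⟨Y, hY, hc, fun h' => absurd h' h⟩
  have hty : Cardinal.lift.{1} #Y = #(Iio boundingNumber.ord) := by
    rw [Cardinal.mk_Iio_ordinal, Cardinal.card_ord, hcard]
  obtain ⟨e⟩ := Cardinal.lift_mk_eq'.1 ((Cardinal.lift_id'.{0, 1} #(Iio boundingNumber.ord)).symm ▸ hty :
    Cardinal.lift.{1} #Y = Cardinal.lift.{0} #(Iio boundingNumber.ord))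
  classical
  let y : Ordinal.{0} → ℕ → ℕ := fun α =>
    if h : α < boundingNumber.ord then (e.symm ⟨α, h⟩ : ℕ → ℕ) else 0
  have hy : ∀ f ∈ Y, ∃ g ∈ scaleFrom y '' Iio boundingNumber.ord, LEStar f g := by
    intro f hf
    have hα := (e ⟨f, hf⟩).2
    obtain ⟨u, -, hu⟩ := scaleFrom_eq y hα
    refine ⟨_, mem_image_of_mem _ hα, Eventually.of_forall fun n => ?_⟩
    have hyf : y (e ⟨f, hf⟩) = f := by
      have : y (e ⟨f, hf⟩) = e.symm ⟨e ⟨f, hf⟩, hα⟩ := dif_pos hα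
      rw [this]
      exact congrArg Subtype.val (e.symm_apply_apply ⟨f, hf⟩)
    rw [hu, hyf]
    exact (Nat.le_add_left _ _).trans (le_increasingMajorant u f n)
  refine ⟨scaleFrom y '' Iio boundingNumber.ord, ⟨?_, ?_, scaleFrom y, rfl, ?_⟩, ?_⟩
  · rintro ⟨b, hb⟩
    refine hY ⟨b, fun f hf => ?_⟩
    obtain ⟨g, hg, hfg⟩ := hy f hf
    exact hfg.trans (hb g hg)
  · rintro _ ⟨α, hα, rfl⟩
    obtain ⟨u, -, hu⟩ := scaleFrom_eq y hα
    rw [hu]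
    exact strictMono_increasingMajorant _ _
  · intro α β hαβ hβ
    obtain ⟨u, hlt, hu⟩ := scaleFrom_eq y hβ
    refine (hlt α hαβ).trans (Eventually.of_forall fun n => ?_)
    rw [hu]
    exact (Nat.le_add_right _ _).trans (le_increasingMajorant u _ n)
  · intro h g
    obtain ⟨f, hf, hgf⟩ := hdom h g
    obtain ⟨k, hk, hfk⟩ := hy f hf
    exact ⟨k, hk, hgf.trans hfk⟩

theorem IsBScale.mk_eq {B : Set (ℕ → ℕ)} (hB : IsBScale B) : #B = boundingNumber := by
  refine le_antisymm ?_ (boundingNumber_le hB.1)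
  obtain ⟨-, -, g, rfl, -⟩ := hB
  simpa using mk_image_Iio_le g boundingNumber.ord

/-- All but fewer than `𝔟` members of a `𝔟`-scale are above a given function on almost all of a
fixed infinite set. -/
theorem IsBScale.exists_infinite_le {B : Set (ℕ → ℕ)} (hB : IsBScale B) (h : ℕ → ℕ) :
    ∃ I : Set ℕ, I.Infinite ∧ ∃ S : Set (ℕ → ℕ), #S < boundingNumber ∧
      ∀ f ∈ B, f ∉ S → ∀ᶠ n in atTop, n ∈ I → h n < f n := by
  obtain ⟨hunb, -, g, rfl, hg⟩ := hB
  obtain ⟨α, hα, hαh⟩ : ∃ α < boundingNumber.ord, ¬ LEStar (g α) h := by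
    by_contra! hc
    exact hunb ⟨h, by rintro _ ⟨α, hα, rfl⟩; exact hc α hα⟩
  -- One member not bounded by h determines the infinite set; later members dominate it, and the
  -- earlier ones are the exceptions.
  refine ⟨{n | h n < g α n}, ?_, g '' Iio α,
    (mk_image_Iio_le g α).trans_lt (Cardinal.lt_ord.1 hα), ?_⟩
  · rw [← Nat.frequently_atTop_iff_infinite]
    simpa only [LEStar, not_eventually, not_le] using hαh
  · rintro _ ⟨β, hβ, rfl⟩ hβα
    have hle : α ≤ β := by
      by_contra hc
      exact hβα (mem_image_of_mem _ (not_le.1 hc))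
    rcases hle.eq_or_lt with rfl | hlt
    · exact Eventually.of_forall fun n hn => hn
    · filter_upwards [hg α β hlt hβ] with n hn hI using lt_of_lt_of_le hI hn

/-! ### The Hurewicz property -/

section Hurewicz

variable {X : Type*} [TopologicalSpace X]

theorem range_mem_gammaCovers {D : ℕ → Set X} (hopen : ∀ n, IsOpen (D n))
    (hne : ∀ n, D n ≠ univ) (hev : ∀ x, ∀ᶠ n in atTop, x ∈ D n) : range D ∈ gammaCovers X := by
  refine ⟨⟨countable_range D, ?_, ?_, ?_⟩, ?_, ?_⟩
  · rintro _ ⟨n, rfl⟩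
    exact hopen n
  · refine eq_univ_of_forall fun x => ?_
    obtain ⟨n, hn⟩ := (hev x).exists
    exact ⟨_, mem_range_self n, hn⟩
  · rintro ⟨n, hn⟩
    exact hne n hn
  -- If there were finitely many members, choose a point outside each; some `D n` would contain all
  -- these points, including its own.
  · intro hfin
    have hx : ∀ V ∈ range D, ∃ x, x ∉ V := by
      rintro _ ⟨n, rfl⟩
      exact (ne_univ_iff_exists_notMem _).1 (hne n)
    choose x hx using hx
    have := hfin.to_subtype
    obtain ⟨n, hn⟩ := (eventually_all.2 fun V : range D => hev (x V V.2)).exists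
    exact hx _ (mem_range_self n) (hn ⟨_, mem_range_self n⟩)
  · intro x
    have hfin : {n | ¬ x ∈ D n}.Finite := by
      have := hev x
      rwa [← Nat.cofinite_eq_atTop, eventually_cofinite] at this
    refine (hfin.image D).subset ?_
    rintro _ ⟨⟨n, rfl⟩, hn⟩
    exact mem_image_of_mem D hn

theorem exists_enum_of_mem_gammaCovers {U : Set (Set X)} (hU : U ∈ gammaCovers X) :
    ∃ e : ℕ → Set X, (∀ j, e j ∈ U) ∧ ∀ x, ∀ᶠ j in atTop, x ∈ e j := by
  obtain ⟨⟨hc, -⟩, hinf, hfin⟩ := hU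
  have := hc.to_subtype
  have := hinf.to_subtype
  obtain ⟨e⟩ := nonempty_equiv_of_countable (α := ℕ) (β := U)
  refine ⟨fun j => e j, fun j => (e j).2, fun x => ?_⟩
  rw [← Nat.cofinite_eq_atTop, eventually_cofinite]
  have hinj : Function.Injective fun j => (e j : Set X) := Subtype.val_injective.comp e.injective
  exact ((hfin x).preimage hinj.injOn).subset fun j hj => ⟨(e j).2, hj⟩

/-- A form of the Hurewicz property in terms of increasing open covers. -/
def IsHurewicz (X : Type*) [TopologicalSpace X] : Prop :=
  ∀ W : ℕ → ℕ → Set X, (∀ n m, IsOpen (W n m)) → (∀ n, Monotone (W n)) →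
    (∀ n x, ∃ m, x ∈ W n m) → ∃ h : ℕ → ℕ, ∀ x, ∀ᶠ n in atTop, x ∈ W n (h n)

theorem IsHurewicz.uFin (hX : IsHurewicz X) : UFin (gammaCovers X) (gammaCovers X) := by
  intro U hU hfin
  choose e heU he using fun n => exists_enum_of_mem_gammaCovers (hU n)
  obtain ⟨h, hh⟩ := hX (fun n m => ⋃₀ (e n '' Iic m))
    (fun n m => isOpen_sUnion (by rintro _ ⟨j, -, rfl⟩; exact (hU n).1.2.1 _ (heU n j)))
    (fun n _ _ hab => sUnion_subset_sUnion (image_mono (Iic_subset_Iic.2 hab)))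
    (fun n x => by
      obtain ⟨j, hj⟩ := (he n x).exists
      exact ⟨j, _, mem_image_of_mem _ self_mem_Iic, hj⟩)
  have hsub : ∀ n, e n '' Iic (h n) ⊆ U n ∧ (e n '' Iic (h n)).Finite := fun n =>
    ⟨by rintro _ ⟨j, -, rfl⟩; exact heU n j, (finite_Iic _).image _⟩
  refine ⟨fun n => e n '' Iic (h n), hsub, range_mem_gammaCovers (fun n => ?_) (fun n hn => ?_) hh⟩
  · exact isOpen_sUnion fun V hV => (hU n).1.2.1 _ ((hsub n).1 hV)
  · exact hfin n ⟨_, (hsub n).1, (hsub n).2, hn⟩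

theorem IsHurewicz.of_surjective {Y : Type*} [TopologicalSpace Y] (hX : IsHurewicz X) {f : X → Y}
    (hf : Continuous f) (hs : Function.Surjective f) : IsHurewicz Y := by
  intro W hopen hmono hcov
  obtain ⟨h, hh⟩ := hX (fun n m => f ⁻¹' W n m) (fun n m => (hopen n m).preimage hf)
    (fun n _ _ hab => preimage_mono (hmono n hab)) (fun n x => hcov n (f x))
  refine ⟨h, fun y => ?_⟩
  obtain ⟨x, rfl⟩ := hs y
  exact hh x

theorem exists_next_of_infinite {I : Set ℕ} (hI : I.Infinite) :
    ∃ next : ℕ → ℕ, ∀ n, next n ∈ I ∧ n ≤ next n := by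
  choose next h1 h2 using fun n => hI.exists_gt n
  exact ⟨next, fun n => ⟨h1 n, (h2 n).le⟩⟩

/-- Replacing W n by the intersection of all W j with j ≤ n, success at an index of I yields success
at every smaller index. -/
theorem isHurewicz_of_infinite
    (H : ∀ W : ℕ → ℕ → Set X, (∀ n m, IsOpen (W n m)) → (∀ n, Monotone (W n)) →
      (∀ n x, ∃ m, x ∈ W n m) → ∃ I : Set ℕ, I.Infinite ∧ ∃ h : ℕ → ℕ,
        ∀ x, ∀ᶠ n in atTop, n ∈ I → x ∈ W n (h n)) : IsHurewicz X := by
  intro W hopen hmono hcov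
  obtain ⟨I, hI, h, hh⟩ := H (fun n m => ⋂ j ∈ Iic n, W j m)
    (fun n m => (finite_Iic n).isOpen_biInter fun j _ => hopen j m)
    (fun n _ _ hab => iInter₂_mono fun j _ => hmono j hab)
    (fun n x => by
      have : ∀ᶠ m in atTop, ∀ j ∈ Iic n, x ∈ W j m :=
        (eventually_all_finite (finite_Iic n)).2 fun j _ => by
          obtain ⟨m, hm⟩ := hcov j x
          filter_upwards [eventually_ge_atTop m] with m' hm' using hmono j hm' hm
      obtain ⟨m, hm⟩ := this.exists
      exact ⟨m, by simpa using hm⟩)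
  obtain ⟨next, hnext⟩ := exists_next_of_infinite hI
  refine ⟨fun n => h (next n), fun x => ?_⟩
  have ht : Tendsto next atTop atTop := tendsto_atTop_mono (fun n => (hnext n).2) tendsto_id
  filter_upwards [ht.eventually (hh x)] with n hn
  have := hn (hnext n).1
  simp only [mem_iInter] at this
  exact this n (hnext n).2

end Hurewicz

/-- The closed sets `C g` decrease, and a point in all of them has only infinite entries at n, so
its components are in Q. By compactness some `C g` lies in O. -/
theorem exists_forall_le_imp_mem {ι : Type*} {O : Set (ι → ℕ → ℕ∞)} (hO : IsOpen O)
    (hQ : ∀ x : ι → ℕ → ℕ∞, (∀ i, x i ∈ Q) → x ∈ O) (n : ℕ) :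
    ∃ g : ℕ, ∀ x : ι → ℕ → ℕ∞, (∀ i, x i ∈ Inc) → (∀ i, (g : ℕ∞) ≤ x i n) → x ∈ O := by
  let C : ℕ → Set (ι → ℕ → ℕ∞) := fun g => ⋂ i, {x | x i ∈ Inc} ∩ {x | (g : ℕ∞) ≤ x i n}
  have hC : ∀ g, IsClosed (C g) := fun g => isClosed_iInter fun i =>
    (isClosed_Inc.preimage (continuous_apply i)).inter
      (isClosed_le continuous_const (by fun_prop))
  have hanti : Antitone C := fun a b hab => iInter_mono fun i x hx =>
    ⟨hx.1, le_trans (Nat.cast_le (α := ℕ∞).2 hab) hx.2⟩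
  obtain ⟨g, hg⟩ := exists_subset_nhds_of_compactSpace (V := C) hanti.directed_ge hC (U := O)
    fun x hx => hO.mem_nhds <| hQ x fun i => by
      simp only [C, mem_iInter, mem_inter_iff, mem_ofPred_eq] at hx
      exact mem_Q_of_mem_Inc (hx 0 i).1 (n := n)
        (ENat.eq_top_iff_forall_ge.2 fun g => (hx g i).2)
  exact ⟨g, fun x h1 h2 => hg (mem_iInter.2 fun i => ⟨h1 i, h2 i⟩)⟩

/-! ### Covering properties of B ∪ Q -/

section Scale

variable {B : Set (ℕ → ℕ)} {H : Set (ℕ → ℕ∞)}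

theorem IsBScale.subset_Inc (hB : IsBScale B) (hH : H = toENatSeq '' B ∪ Q) : H ⊆ Inc := by
  rw [hH]
  refine union_subset ?_ Q_subset_Inc
  rintro _ ⟨f, hf, rfl⟩
  exact toENatSeq_mem_Inc (hB.2.1 f hf)

theorem IsBScale.mk_union_Q (hB : IsBScale B) (hH : H = toENatSeq '' B ∪ Q) :
    #H = boundingNumber := by
  have hBc : #(toENatSeq '' B) = boundingNumber := by
    rw [Cardinal.mk_image_eq toENatSeq_injective, hB.mk_eq]
  refine le_antisymm ?_ ?_
  · rw [hH]
    refine (Cardinal.mk_union_le _ _).trans ?_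
    rw [hBc]
    exact Cardinal.add_le_of_le aleph0_lt_boundingNumber.le le_rfl
      ((Cardinal.le_aleph0_iff_set_countable.2 countable_Q).trans aleph0_lt_boundingNumber.le)
  · rw [← hBc, hH]
    exact Cardinal.mk_le_mk_of_subset subset_union_left

theorem mk_union_Q_lt {S : Set (ℕ → ℕ)} (hS : #S < boundingNumber) :
    #(toENatSeq '' S ∪ Q : Set (ℕ → ℕ∞)) < boundingNumber := by
  refine (Cardinal.mk_union_le _ _).trans_lt ?_
  refine Cardinal.add_lt_of_lt aleph0_lt_boundingNumber.le (Cardinal.mk_image_le.trans_lt hS) ?_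
  exact (Cardinal.le_aleph0_iff_set_countable.2 countable_Q).trans_lt aleph0_lt_boundingNumber

theorem mk_subtype_mem_le (T : Set (ℕ → ℕ∞)) : #{y : H // y.1 ∈ T} ≤ #T :=
  Cardinal.mk_le_of_injective (f := fun y => (⟨y.1.1, y.2⟩ : T)) fun _ _ h =>
    Subtype.ext (Subtype.ext (congrArg (fun t : T => t.1) h))

/-- Extend the cover to ambient open sets. Their union contains a compact set {x | g ≤ x i n for all
i}, so finitely many suffice, and monotonicity leaves a single m. -/
theorem IsBScale.exists_forall_le_imp_mem_of_cover (hB : IsBScale B)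
    (hH : H = toENatSeq '' B ∪ Q) {k : ℕ} {W : ℕ → Set (Fin k → H)} (hopen : ∀ m, IsOpen (W m))
    (hmono : Monotone W) (hcov : ∀ x, ∃ m, x ∈ W m) (n : ℕ) :
    ∃ g m : ℕ, ∀ x : Fin k → H, (∀ i, (g : ℕ∞) ≤ (x i).1 n) → x ∈ W m := by
  have hind : Topology.IsInducing (Pi.map fun (_ : Fin k) => (Subtype.val : H → ℕ → ℕ∞)) :=
    Topology.IsInducing.piMap fun _ => Topology.IsInducing.subtypeVal
  choose V hV hVW using fun m => hind.isOpen_iff.1 (hopen m)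
  have hQ : ∀ x : Fin k → ℕ → ℕ∞, (∀ i, x i ∈ Q) → x ∈ ⋃ m, V m := fun x hx => by
    obtain ⟨m, hm⟩ := hcov fun i => ⟨x i, hH ▸ Or.inr (hx i)⟩
    rw [← hVW m] at hm
    exact mem_iUnion.2 ⟨m, hm⟩
  obtain ⟨g, hg⟩ := exists_forall_le_imp_mem (isOpen_iUnion hV) hQ n
  have hcpt : IsCompact (⋂ i : Fin k, {x : Fin k → ℕ → ℕ∞ | x i ∈ Inc} ∩
      {x | (g : ℕ∞) ≤ x i n}) :=
    (isClosed_iInter fun i => (isClosed_Inc.preimage (continuous_apply i)).inter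
      (isClosed_le continuous_const (by fun_prop))).isCompact
  obtain ⟨t, ht⟩ := hcpt.elim_finite_subcover V hV fun x hx =>
    hg x (fun i => (mem_iInter.1 hx i).1) (fun i => (mem_iInter.1 hx i).2)
  refine ⟨g, t.sup id, fun x hx => ?_⟩
  have := ht (show Pi.map (fun _ => Subtype.val) x ∈ _ from
    mem_iInter.2 fun i => ⟨hB.subset_Inc hH (x i).2, hx i⟩)
  simp only [mem_iUnion] at this
  obtain ⟨m, hm, hxm⟩ := this
  have hxW : x ∈ W m := by
    rw [← hVW m]
    exact hxm
  exact hmono (Finset.le_sup (f := id) hm) hxW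

theorem IsBScale.isHurewicz_pow (hB : IsBScale B) (hH : H = toENatSeq '' B ∪ Q) (k : ℕ) :
    IsHurewicz (Fin k → H) := by
  induction k with
  | zero =>
    intro W _ _ hcov
    choose h hh using fun n => hcov n default
    exact ⟨h, fun x => Eventually.of_forall fun n => Subsingleton.elim default x ▸ hh n⟩
  | succ k ih =>
    refine isHurewicz_of_infinite fun W hopen hmono hcov => ?_
    choose g m hgm using fun n =>
      hB.exists_forall_le_imp_mem_of_cover hH (hopen n) (hmono n) (hcov n) n
    obtain ⟨I, hI, S, hS, hIS⟩ := hB.exists_infinite_le g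
    -- Points with no component in T are caught by g and m; the others lie in slices obtained by
    -- fixing one component in T.
    let T : Set (ℕ → ℕ∞) := toENatSeq '' S ∪ Q
    have hcard : #(Fin (k + 1) × {y : H // y.1 ∈ T}) < boundingNumber := by
      rw [Cardinal.mk_prod, Cardinal.lift_id, Cardinal.lift_id]
      exact Cardinal.mul_lt_of_lt aleph0_lt_boundingNumber.le
        ((Cardinal.mk_lt_aleph0).trans aleph0_lt_boundingNumber)
        ((mk_subtype_mem_le T).trans_lt (mk_union_Q_lt hS))
    have hslice : ∀ p : Fin (k + 1) × {y : H // y.1 ∈ T}, ∃ h : ℕ → ℕ,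
        ∀ x : Fin k → H, ∀ᶠ n in atTop, Fin.insertNth (α := fun _ => H) p.1 p.2.1 x ∈ W n (h n) :=
      fun p => ih
        (fun n m => (fun x : Fin k → H => Fin.insertNth (α := fun _ => H) p.1 p.2.1 x) ⁻¹' W n m)
        (fun n m => (hopen n m).preimage
          (Continuous.finInsertNth (A := fun _ => H) p.1 continuous_const continuous_id))
        (fun n _ _ hab => preimage_mono (hmono n hab)) (fun n x => hcov n _)
    choose h hh using hslice
    obtain ⟨b, hb⟩ := exists_bound_of_card_lt hcard h
    refine ⟨I, hI, fun n => max (m n) (b n), fun x => ?_⟩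
    by_cases hx : ∃ i, (x i).1 ∈ T
    · obtain ⟨i, hi⟩ := hx
      filter_upwards [hh (i, ⟨x i, hi⟩) (Fin.removeNth i x), hb (i, ⟨x i, hi⟩)] with n h1 h2 _
      rw [Fin.insertNth_self_removeNth] at h1
      exact hmono n (h2.trans (le_max_right _ _)) h1
    · push Not at hx
      have hev : ∀ i, ∀ᶠ n in atTop, n ∈ I → (g n : ℕ∞) ≤ (x i).1 n := fun i => by
        have hxH : (x i).1 ∈ toENatSeq '' B ∪ Q := hH ▸ (x i).2
        rcases hxH with ⟨f, hf, hfx⟩ | hq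
        · have hfS : f ∉ S := fun h => hx i (Or.inl ⟨f, h, hfx⟩)
          filter_upwards [hIS f hf hfS] with n hn hnI
          rw [← hfx]
          exact Nat.cast_le.2 (hn hnI).le
        · exact absurd (Or.inr hq) (hx i)
      filter_upwards [eventually_all.2 hev] with n hn hnI
      exact hmono n (le_max_left _ _) (hgm n x fun i => hn i hnI)

theorem IsBScale.isHurewicz (hB : IsBScale B) (hH : H = toENatSeq '' B ∪ Q) : IsHurewicz H :=
  (hB.isHurewicz_pow hH 1).of_surjective (continuous_apply 0) fun y => ⟨fun _ => y, rfl⟩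

/-- A member of B above g at a single suitable n is already in G, and only members of S can avoid
this. -/
theorem IsBScale.exists_small_of_isOpen (hB : IsBScale B) (hH : H = toENatSeq '' B ∪ Q)
    {G : Set H} (hG : IsOpen G) (hQ : ∀ x : H, x.1 ∈ Q → x ∈ G) : #(Gᶜ : Set H) < boundingNumber := by
  obtain ⟨O, hO, rfl⟩ := isOpen_induced_iff.1 hG
  choose g hg using exists_forall_le_imp_mem (ι := Unit) (hO.preimage (continuous_apply ()))
    fun x hx => hQ ⟨x (), hH ▸ Or.inr (hx ())⟩ (hx ())
  obtain ⟨I, hI, S, hS, hIS⟩ := hB.exists_infinite_le g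
  have hsub : ∀ x : H, x ∉ Subtype.val ⁻¹' O → x.1 ∈ toENatSeq '' S := fun x hx => by
    have hxH : x.1 ∈ toENatSeq '' B ∪ Q := hH ▸ x.2
    rcases hxH with ⟨f, hf, hfx⟩ | hq
    · refine ⟨f, ?_, hfx⟩
      by_contra hfS
      obtain ⟨n, hn, hnI⟩ :=
        ((Nat.frequently_atTop_iff_infinite.2 hI).and_eventually (hIS f hf hfS)).exists
      refine hx (hg n (fun _ => x.1) (fun _ => hB.subset_Inc hH x.2) fun _ => ?_)
      rw [← hfx]
      exact Nat.cast_le.2 (hnI hn).le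
    · exact absurd (hQ x hq) hx
  refine lt_of_le_of_lt ?_ (Cardinal.mk_image_le.trans_lt hS : #(toENatSeq '' S) < _)
  exact (Cardinal.mk_le_mk_of_subset (t := {x : H | x.1 ∈ toENatSeq '' S}) fun x hx =>
    hsub x hx).trans (mk_subtype_mem_le _)

theorem IsBScale.sOne (hB : IsBScale B) (hH : H = toENatSeq '' B ∪ Q) :
    SOne (gammaCovers H) (openCovers H) := by
  intro U hU
  choose e heU he using fun n => exists_enum_of_mem_gammaCovers (hU n)
  have hne : Q.Nonempty := ⟨_, [], List.Pairwise.nil, rfl⟩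
  obtain ⟨q, hq⟩ := countable_Q.exists_eq_range hne
  have hqH : ∀ i, q i ∈ H := fun i => hH ▸ Or.inr (hq ▸ mem_range_self i)
  -- Even-indexed covers are spent on the countable set Q, odd-indexed ones on the fewer than 𝔟
  -- points left over.
  choose c hc using fun i => (he (2 * i) ⟨q i, hqH i⟩).exists
  let G : Set H := ⋃ i, e (2 * i) (c i)
  have hG : IsOpen G := isOpen_iUnion fun i => (hU _).1.2.1 _ (heU _ _)
  have hGQ : ∀ x : H, x.1 ∈ Q → x ∈ G := fun x hx => by
    rw [hq] at hx
    obtain ⟨i, hi⟩ := hx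
    refine mem_iUnion.2 ⟨i, ?_⟩
    convert hc i using 1
    exact Subtype.ext hi.symm
  -- From index `f x i` on, cover 2i + 1 always catches x; so a common bound of these functions
  -- catches x for almost all i.
  choose f hf using fun (x : (Gᶜ : Set H)) i => eventually_atTop.1 (he (2 * i + 1) x.1)
  obtain ⟨h, hh⟩ := exists_bound_of_card_lt (hB.exists_small_of_isOpen hH hG hGQ) f
  let V : ℕ → Set H := fun n => e n (if Even n then c (n / 2) else h (n / 2))
  have hV : ∀ n, V n ∈ U n := fun n => heU n _
  refine ⟨V, hV, countable_range V, ?_, ?_, ?_⟩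
  · rintro _ ⟨n, rfl⟩
    exact (hU n).1.2.1 _ (hV n)
  · refine eq_univ_of_forall fun x => ?_
    by_cases hx : x ∈ G
    · obtain ⟨i, hi⟩ := mem_iUnion.1 hx
      exact ⟨V (2 * i), mem_range_self _, by simpa [V] using hi⟩
    · obtain ⟨i, hi⟩ := (hh ⟨x, hx⟩).exists
      refine ⟨V (2 * i + 1), mem_range_self _, ?_⟩
      have h1 : ¬ Even (2 * i + 1) := by simp
      have h2 : (2 * i + 1) / 2 = i := by omega
      simp only [V, h1, if_false, h2]
      exact hf ⟨x, hx⟩ i _ hi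
  · rintro ⟨n, hn⟩
    exact (hU n).1.2.2.2 (hn ▸ hV n)

end Scale

/-! ### Failure of σ-compactness -/

/-- A space with `S₁(Γ, 𝒪)` does not contain a copy of the Cantor space. -/
theorem not_sOne_of_cantor {X : Type*} [TopologicalSpace X] [T2Space X] {f : (ℕ → Bool) → X}
    (hf : Continuous f) (hinj : Function.Injective f) :
    ¬ SOne (gammaCovers X) (openCovers X) := by
  intro hS
  -- For fixed n the code sets are disjoint, so their complements form a γ-cover. Any selection
  -- misses the image of a point lying in all the corresponding code sets.
  obtain ⟨V, hV, hcov⟩ := hS (fun n => range fun m => (f '' codeSet n m)ᶜ) fun n => by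
    refine range_mem_gammaCovers (fun m => ?_) (fun m h => ?_) fun x => ?_
    · exact ((isClosed_codeSet n m).isCompact.image hf).isClosed.isOpen_compl
    · obtain ⟨a, ha⟩ := exists_mem_codeSet fun _ => m
      have : f a ∈ (f '' codeSet n m)ᶜ := h ▸ mem_univ _
      exact this (mem_image_of_mem f (ha n))
    · by_cases hx : ∃ m, x ∈ f '' codeSet n m
      · obtain ⟨m, a, ha, rfl⟩ := hx
        filter_upwards [eventually_gt_atTop m] with m' hm'
        rintro ⟨b, hb, hba⟩
        rw [hinj hba] at hb
        exact hm'.ne (eq_of_mem_codeSet ha hb)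
      · exact Eventually.of_forall fun m hm => hx ⟨m, hm⟩
  choose m hm using hV
  obtain ⟨a, ha⟩ := exists_mem_codeSet m
  have hfa : f a ∈ ⋃₀ range V := hcov.2.2.1 ▸ mem_univ _
  obtain ⟨_, ⟨n, rfl⟩, hn⟩ := hfa
  rw [← hm n] at hn
  exact hn (mem_image_of_mem f (ha n))

/-- Some compact piece would be uncountable; being closed in the Polish space `Inc`, it would
contain a Cantor set. -/
theorem not_isSigmaCompact_of_sOne {H : Set (ℕ → ℕ∞)} (hInc : H ⊆ Inc) (hunc : ¬ H.Countable)
    (hS : SOne (gammaCovers H) (openCovers H)) : ¬ IsSigmaCompact H := by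
  rintro ⟨K, hK, hKH⟩
  obtain ⟨n, hn⟩ : ∃ n, ¬ (K n).Countable := by
    by_contra! hc
    exact hunc (hKH ▸ countable_iUnion hc)
  have hKsub : K n ⊆ H := hKH ▸ subset_iUnion K n
  have := polishSpace_Inc
  have hclosed : IsClosed (Subtype.val ⁻¹' K n : Set Inc) :=
    (hK n).isClosed.preimage continuous_subtype_val
  obtain ⟨f, hf, hcont, hinj⟩ := hclosed.exists_nat_bool_injection_of_not_countable fun hc => by
    refine hn ((hc.image Subtype.val).mono fun x hx => ?_)
    exact ⟨⟨x, hInc (hKsub hx)⟩, hx, rfl⟩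
  have hmem : ∀ a, (f a).1 ∈ H := fun a => hKsub (hf (mem_range_self a))
  refine not_sOne_of_cantor (f := fun a => (⟨(f a).1, hmem a⟩ : H)) ?_ ?_ hS
  · exact (continuous_subtype_val.comp hcont).subtype_mk _
  · intro a b hab
    exact hinj (Subtype.ext (Subtype.mk.inj hab))

/-! ### Failure of the covering properties without Q -/

section NotUFin

variable {B : Set (ℕ → ℕ)}

/-- The sets of points whose `n`th coordinate is less than `m`. -/
def coordLT (B : Set (ℕ → ℕ)) (n m : ℕ) : Set (toENatSeq '' B) := {x | x.1 n < (m : ℕ∞)}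

theorem coordLT_mono (n : ℕ) : Monotone (coordLT B n) := fun a b hab x hx => by
  have h : x.1 n < (a : ℕ∞) := hx
  exact show x.1 n < (b : ℕ∞) from h.trans_le (Nat.cast_le.2 hab)

theorem coordLT_ne_univ {n m : ℕ} (h : ∃ f ∈ B, m ≤ f n) : coordLT B n m ≠ univ := by
  obtain ⟨f, hf, hm⟩ := h
  intro hu
  have : (⟨toENatSeq f, mem_image_of_mem _ hf⟩ : toENatSeq '' B) ∈ coordLT B n m := hu ▸ mem_univ _
  exact absurd (Nat.cast_lt.1 (show (f n : ℕ∞) < m from this)) (not_lt.2 hm)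

theorem range_coordLT_mem {n : ℕ} (h : ∀ m, ∃ f ∈ B, m ≤ f n) :
    range (coordLT B n) ∈ gammaCovers (toENatSeq '' B) := by
  refine range_mem_gammaCovers (fun m => ?_) (fun m => coordLT_ne_univ (h m)) ?_
  · exact isOpen_Iio.preimage ((continuous_apply n).comp continuous_subtype_val)
  · rintro ⟨_, f, hf, rfl⟩
    filter_upwards [eventually_gt_atTop (f n)] with m hm
    exact Nat.cast_lt (α := ℕ∞).2 hm

theorem exists_sUnion_subset_coordLT {n : ℕ} {F : Set (Set (toENatSeq '' B))}
    (hF : F ⊆ range (coordLT B n)) (hfin : F.Finite) : ∃ m, ⋃₀ F ⊆ coordLT B n m := by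
  have : ∀ᶠ m in atTop, ∀ V ∈ F, V ⊆ coordLT B n m :=
    (eventually_all_finite hfin).2 fun V hV => by
      obtain ⟨m, rfl⟩ := hF hV
      filter_upwards [eventually_ge_atTop m] with m' hm' using coordLT_mono n hm'
  obtain ⟨m, hm⟩ := this.exists
  exact ⟨m, sUnion_subset hm⟩

theorem not_hasFiniteSubcover_coordLT {n : ℕ} (h : ∀ m, ∃ f ∈ B, m ≤ f n) :
    ¬ HasFiniteSubcover (range (coordLT B n)) := by
  rintro ⟨F, hF, hfin, hu⟩
  obtain ⟨m, hm⟩ := exists_sUnion_subset_coordLT hF hfin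
  exact coordLT_ne_univ (h m) (univ_subset_iff.1 (hu ▸ hm))

/-- Otherwise B is bounded at arbitrarily late coordinates, hence, its members being increasing, at
all of them. -/
theorem IsBScale.exists_unbounded_coords (hB : IsBScale B) :
    ∃ N, ∀ n ≥ N, ∀ m, ∃ f ∈ B, m ≤ f n := by
  by_contra! hc
  choose n hn m hm using hc
  refine hB.1 ⟨m, fun f hf => Eventually.of_forall fun k => ?_⟩
  exact ((hB.2.1 f hf).monotone (hn k)).trans (hm k f hf).le

theorem IsBScale.not_uFin_gamma (hB : IsBScale B) :
    ¬ UFin (gammaCovers (toENatSeq '' B)) (gammaCovers (toENatSeq '' B)) := by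
  intro hU
  obtain ⟨N, hN⟩ := hB.exists_unbounded_coords
  obtain ⟨F, hF, hγ⟩ := hU (fun n => range (coordLT B (n + N)))
    (fun n => range_coordLT_mem (hN _ (Nat.le_add_left _ _)))
    (fun n => not_hasFiniteSubcover_coordLT (hN _ (Nat.le_add_left _ _)))
  choose h hh using fun n => exists_sUnion_subset_coordLT (hF n).1 (hF n).2
  -- The finite unions may repeat. On J each occurs once, so a point misses only finitely many
  -- indices of J.
  obtain ⟨J, -, hJ⟩ := exists_subset_bijOn univ fun n => ⋃₀ F n
  rw [image_univ] at hJ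
  have hJinf : J.Infinite := fun hfin => hγ.2.1 (hJ.image_eq ▸ hfin.image _)
  obtain ⟨next, hnext⟩ := exists_next_of_infinite hJinf
  have ht : Tendsto next atTop atTop := tendsto_atTop_mono (fun n => (hnext n).2) tendsto_id
  refine hB.1 ⟨fun n => h (next n), fun f hf => ?_⟩
  let x : toENatSeq '' B := ⟨toENatSeq f, mem_image_of_mem _ hf⟩
  have hfin : {n | ¬ (n ∈ J → x ∈ ⋃₀ F n)}.Finite := by
    have hsub : {n | ¬ (n ∈ J → x ∈ ⋃₀ F n)} ⊆
        J ∩ (fun n => ⋃₀ F n) ⁻¹' {V ∈ range fun n => ⋃₀ F n | x ∉ V} := fun n hn => by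
      rw [mem_ofPred_eq, Classical.not_imp] at hn
      exact ⟨hn.1, mem_range_self n, hn.2⟩
    refine Finite.subset (Finite.of_finite_image (f := fun n => ⋃₀ F n) ?_ ?_) hsub
    · exact (hγ.2.2 x).subset (by rintro _ ⟨n, hn, rfl⟩; exact hn.2)
    · exact hJ.injOn.mono inter_subset_left
  have hev : ∀ᶠ n in atTop, n ∈ J → x ∈ ⋃₀ F n := by
    rwa [← Nat.cofinite_eq_atTop, eventually_cofinite]
  filter_upwards [ht.eventually hev] with n hn
  have hlt : (f (next n + N) : ℕ∞) < h (next n) := hh _ (hn (hnext n).1)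
  have hle : f n ≤ f (next n + N) :=
    (hB.2.1 f hf).monotone ((hnext n).2.trans (Nat.le_add_right _ _))
  exact hle.trans (Nat.cast_lt.1 hlt).le

theorem IsBScale.not_uFin_open (hB : IsBScale B) (hdom : IsDominating B) :
    ¬ UFin (gammaCovers (toENatSeq '' B)) (openCovers (toENatSeq '' B)) := by
  intro hU
  obtain ⟨N, hN⟩ := hB.exists_unbounded_coords
  -- A cover catches each point only at some n, perhaps too early for domination to apply; hence one
  -- selection for every starting index k.
  choose F hF hcov using fun k => hU (fun n => range (coordLT B (n + k + N)))
    (fun n => range_coordLT_mem (hN _ (Nat.le_add_left _ _)))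
    (fun n => not_hasFiniteSubcover_coordLT (hN _ (Nat.le_add_left _ _)))
  choose h hh using fun k n => exists_sUnion_subset_coordLT (hF k n).1 (hF k n).2
  obtain ⟨f, hf, hle⟩ := hdom fun i =>
    ∑ k ∈ Finset.range (i + 1), ∑ n ∈ Finset.range (i + 1), h k n
  obtain ⟨k, hk⟩ := eventually_atTop.1 hle
  have hx : (⟨toENatSeq f, mem_image_of_mem _ hf⟩ : toENatSeq '' B) ∈
      ⋃₀ range fun n => ⋃₀ F k n := (hcov k).2.2.1 ▸ mem_univ _
  obtain ⟨_, ⟨n, rfl⟩, hn⟩ := hx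
  have hlt : (f (n + k + N) : ℕ∞) < h k n := hh k n hn
  have h1 := hk (n + k + N) (by omega)
  have h2 : h k n ≤ ∑ n' ∈ Finset.range (n + k + N + 1), h k n' :=
    Finset.single_le_sum (f := fun n' => h k n') (fun _ _ => Nat.zero_le _)
      (Finset.mem_range.2 (by omega))
  have h3 := Finset.single_le_sum
    (f := fun k' => ∑ n' ∈ Finset.range (n + k + N + 1), h k' n') (s := Finset.range (n + k + N + 1))
    (fun _ _ => Nat.zero_le _) (Finset.mem_range.2 (show k < n + k + N + 1 by omega))
  exact absurd (Nat.cast_lt.1 hlt) (not_lt.2 (h2.trans (h3.trans h1)))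

end NotUFin

end SelectionPrinciples

open SelectionPrinciples
theorem mainTheorem1 :
    Nonempty (Inc ≃ₜ (ℕ → Bool)) ∧ Q ⊆ Inc ∧ Q.Countable ∧
    ∃ (B : Set (ℕ → ℕ)) (H : Set (ℕ → ℕ∞)),
      IsBScale B ∧ H = toENatSeq '' B ∪ Q ∧ H ⊆ Inc ∧
      ¬ IsSigmaCompact H ∧
      #H = boundingNumber ∧
      SOne (gammaCovers H) (openCovers H) ∧
      UFin (gammaCovers H) (gammaCovers H) ∧
      (∀ k : ℕ, UFin (gammaCovers (Fin k → H)) (gammaCovers (Fin k → H))) ∧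
      ¬ UFin (gammaCovers ↥(H \ Q)) (gammaCovers ↥(H \ Q)) ∧
      (boundingNumber = dominatingNumber →
        ¬ UFin (gammaCovers ↥(H \ Q)) (openCovers ↥(H \ Q))) := by
  refine ⟨nonempty_homeomorph_Inc, Q_subset_Inc, countable_Q, ?_⟩
  obtain ⟨B, hB, hdom⟩ := exists_isBScale
  obtain ⟨H, hH⟩ : ∃ H, H = toENatSeq '' B ∪ Q := ⟨_, rfl⟩
  have hcard := hB.mk_union_Q hH
  have hunc : ¬ H.Countable := fun h =>
    (Cardinal.le_aleph0_iff_set_countable.2 h).not_gt (hcard ▸ aleph0_lt_boundingNumber)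
  have hdiff : H \ Q = toENatSeq '' B := by
    rw [hH, union_sdiff_right, sdiff_eq_left, disjoint_left]
    rintro _ ⟨f, -, rfl⟩
    exact toENatSeq_notMem_Q f
  refine ⟨B, H, hB, hH, hB.subset_Inc hH,
    not_isSigmaCompact_of_sOne (hB.subset_Inc hH) hunc (hB.sOne hH), hcard, hB.sOne hH,
    (hB.isHurewicz hH).uFin, fun k => (hB.isHurewicz_pow hH k).uFin, ?_, fun h => ?_⟩
  · rw [hdiff]
    exact hB.not_uFin_gamma
  · rw [hdiff]
    exact hB.not_uFin_open (hdom h)
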